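/- **Setting.** A system $A$ is a (possibly empty) tensor product of qudits, each of odd prime dimension, with Hilbert space $\mathcal H_A$ of dimension $d_A$. On a qudit of odd prime dimension $d$ with computational basis $\{|j\rangle\}_{j\in\mathbb Z_d}$ let $X|j\rangle=|j+1\rangle$, $Z|j\rangle=\omega^j|j\rangle$ with $\omega=e^{2\pi i/d}$, and let $T_{(a_1,a_2)}=\tau^{-a_1a_2}Z^{a_1}X^{a_2}$ with $\tau=e^{(d+1)\pi i/d}$ and $(a_1,a_2)\in\mathbb Z_d\times\mathbb Z_d$ (represented by integers in $\{0,\dots,d-1\}$). On a composite system the phase space is the product of the phase spaces of the subsystems and $T_{(\mathbf u_A,\mathbf u_B)}=T_{\mathbf u_A}\otimes T_{\mathbf u_B}$. The phase-space point operators of a system $A$ are $A_{\mathbf 0}=\frac1{d_A}\sum_{\mathbf u}T_{\mathbf u}$ and $A_{\mathbf u}=T_{\mathbf u}A_{\mathbf 0}T_{\mathbf u}^\dagger$, and the Wigner trace norm of an operator $V$ on $\mathcal H_A$ is $\|V\|_{W,1}=\sum_{\mathbf u}\frac1{d_A}\left|\operatorname{tr}[A_{\mathbf u}V]\right|$. For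 a completely positive map $\mathcal E_{A\to B}$, its mana is $\mathcal M(\mathcal E)=\log_2\max_{\mathbf u}\|\mathcal E(A_{\mathbf u})\|_{W,1}$, where $\mathbf u$ ranges over the phase space of $A$ and $\log_2 0=-\infty$. For positive semi-definite $\rho,\sigma$ let $D_{\max}(\rho\|\sigma)=\inf\{\lambda\in\mathbb R:\rho\le 2^\lambda\sigma\}$, which is $+\infty$ if there is no such $\lambda$. For completely positive maps $\mathcal N,\mathcal E$ from $A$ to $B$ let $$D_{\max}(\mathcal N\|\mathcal E)=\sup_{\psi_{RA}}D_{\max}\big((\mathrm{id}_R\otimes\mathcal N)(\psi_{RA})\,\big\|\,(\mathrm{id}_R\otimes\mathcal E)(\psi_{RA})\big),$$ where $\psi_{RA}$ ranges over all pure states and $R$ is a copy of $A$. The max-thauma of a quantum channel (a completely positive trace-preserving linear map) $\mathcal N_{A\to B}$ is $$\theta_{\max}(\mathcal N)=\inf_{\mathcal E}D_{\max}(\mathcal N\|\mathcal E),$$ where the infimum is over all completely positive maps $\mathcal E_{A\to B}$ with $\mathcal M(\mathcal E)\le 0$. **Proposition (additivity).** For all systems $A_1,B_1,A_2,B_2$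 as above and all quantum channels $\mathcal N_1$ from $A_1$ to $B_1$ and $\mathcal N_2$ from $A_2$ to $B_2$, the max-thauma is additive under tensor products: $$\theta_{\max}(\mathcal N_1\otimes\mathcal N_2)=\theta_{\max}(\mathcal N_1)+\theta_{\max}(\mathcal N_2).$$ -/

import Mathlib

namespace ChannelMagic

noncomputable section

open scoped ComplexOrder Kronecker

/-! ## Systems and Heisenberg--Weyl operators -/

/-- A quantum system: a (possibly empty) tensor product of qudits of odd prime dimension. -/
inductive QSystem : Type
  | trivial : QSystem
  | qudit (d : ℕ) (hp : d.Prime) (hodd : Odd d) : QSystem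
  | tensor (A B : QSystem) : QSystem

/-- The labels of the computational basis. -/
def QSystem.Basis : QSystem → Type
  | .trivial => Unit
  | .qudit d _ _ => ZMod d
  | .tensor A B => A.Basis × B.Basis

instance QSystem.instFintypeBasis : (A : QSystem) → Fintype A.Basis
  | .trivial => inferInstanceAs (Fintype Unit)
  | .qudit d hp _ =>
      haveI : NeZero d := ⟨hp.ne_zero⟩
      inferInstanceAs (Fintype (ZMod d))
  | .tensor A B =>
      letI := QSystem.instFintypeBasis A
      letI := QSystem.instFintypeBasis B
      inferInstanceAs (Fintype (A.Basis × B.Basis))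

instance QSystem.instDecidableEqBasis : (A : QSystem) → DecidableEq A.Basis
  | .trivial => inferInstanceAs (DecidableEq Unit)
  | .qudit d _ _ => inferInstanceAs (DecidableEq (ZMod d))
  | .tensor A B =>
      letI := QSystem.instDecidableEqBasis A
      letI := QSystem.instDecidableEqBasis B
      inferInstanceAs (DecidableEq (A.Basis × B.Basis))

/-- The discrete phase space: `ℤ_d × ℤ_d` for a qudit, products of these for composite systems. -/
def QSystem.Phase : QSystem → Type
  | .trivial => Unit
  | .qudit d _ _ => ZMod d × ZMod d
  | .tensor A B => A.Phase × B.Phase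

instance QSystem.instFintypePhase : (A : QSystem) → Fintype A.Phase
  | .trivial => inferInstanceAs (Fintype Unit)
  | .qudit d hp _ =>
      haveI : NeZero d := ⟨hp.ne_zero⟩
      inferInstanceAs (Fintype (ZMod d × ZMod d))
  | .tensor A B =>
      letI := QSystem.instFintypePhase A
      letI := QSystem.instFintypePhase B
      inferInstanceAs (Fintype (A.Phase × B.Phase))

/-- The phase-space origin. -/
def QSystem.origin : (A : QSystem) → A.Phase
  | .trivial => ()
  | .qudit _ _ _ => (0, 0)
  | .tensor A B => (A.origin, B.origin)

instance QSystem.instNonemptyPhase (A : QSystem) : Nonempty A.Phase := ⟨A.origin⟩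

/-- The dimension of the Hilbert space of a system. -/
def QSystem.dim (A : QSystem) : ℕ := Fintype.card A.Basis

/-- Linear operators on the Hilbert space of a system, in the computational basis. -/
abbrev Op (A : QSystem) : Type := Matrix A.Basis A.Basis ℂ

/-- The shift operator `X |j⟩ = |j + 1⟩` on a qudit. -/
def shiftX (d : ℕ) : Matrix (ZMod d) (ZMod d) ℂ :=
  Matrix.of fun i j => if i = j + 1 then 1 else 0

/-- The boost operator `Z |j⟩ = ω ^ j |j⟩`, `ω = exp (2πi / d)`, on a qudit. -/
def boostZ (d : ℕ) : Matrix (ZMod d) (ZMod d) ℂ :=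
  Matrix.diagonal fun j => Complex.exp (2 * Real.pi * Complex.I / d) ^ j.val

/-- The phase `τ = exp ((d + 1) πi / d)`. -/
def tau (d : ℕ) : ℂ := Complex.exp ((d + 1) * Real.pi * Complex.I / d)

/-- The Heisenberg--Weyl operator `T_u`: `τ ^ (-a₁ a₂) Z ^ a₁ X ^ a₂` on a qudit, and the tensor
product of the Heisenberg--Weyl operators of the subsystems on a composite system. -/
def weyl : (A : QSystem) → A.Phase → Op A
  | .trivial, _ => 1
  | .qudit d hp _, u =>
      haveI : NeZero d := ⟨hp.ne_zero⟩
      (show Matrix (ZMod d) (ZMod d) ℂ from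
        tau d ^ (-((u.1.val : ℤ) * (u.2.val : ℤ))) • (boostZ d ^ u.1.val * shiftX d ^ u.2.val))
  | .tensor A B, u =>
      (show Matrix (A.Basis × B.Basis) (A.Basis × B.Basis) ℂ from
        weyl A u.1 ⊗ₖ weyl B u.2)

/-! ## Phase-space point operators and Wigner functions -/

/-- `A_0 = (1 / d) ∑ᵤ T_u`. -/
def phasePointZero (A : QSystem) : Op A := (1 / (A.dim : ℂ)) • ∑ u : A.Phase, weyl A u

/-- The phase-space point operator `A_u = T_u A_0 T_u†`. -/
def phasePoint (A : QSystem) (u : A.Phase) : Op A :=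
  weyl A u * phasePointZero A * (weyl A u).conjTranspose

/-- The discrete Wigner function `W_X(u) = (1 / d) tr[A_u X]` (real-valued for Hermitian `X`). -/
def wigner (A : QSystem) (X : Op A) (u : A.Phase) : ℂ :=
  (1 / (A.dim : ℂ)) * (phasePoint A u * X).trace

/-- The Wigner trace norm `‖X‖_{W,1} = ∑ᵤ |W_X(u)|`. -/
def wignerTraceNorm (A : QSystem) (X : Op A) : ℝ := ∑ u : A.Phase, ‖wigner A X u‖

/-! ## Linear maps between operators, complete positivity, channels -/

/-- The tensor product `Φ ⊗ Ψ` of two linear maps between matrix algebras: the linear map that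
sends `|i⟩⟨j| ⊗ |k⟩⟨l|` to `Φ(|i⟩⟨j|) ⊗ Ψ(|k⟩⟨l|)`. -/
def mapTensor {a b a' b' : Type} [Fintype a] [DecidableEq a] [Fintype a'] [DecidableEq a']
    (Φ : Matrix a a ℂ →ₗ[ℂ] Matrix b b ℂ) (Ψ : Matrix a' a' ℂ →ₗ[ℂ] Matrix b' b' ℂ) :
    Matrix (a × a') (a × a') ℂ →ₗ[ℂ] Matrix (b × b') (b × b') ℂ where
  toFun X := ∑ i, ∑ j, ∑ k, ∑ l,
    X (i, k) (j, l) • (Φ (Matrix.single i j 1) ⊗ₖ Ψ (Matrix.single k l 1))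
  map_add' X Y := by simp only [Matrix.add_apply, add_smul, Finset.sum_add_distrib]
  map_smul' c X := by
    simp only [Matrix.smul_apply, smul_eq_mul, mul_smul, Finset.smul_sum, RingHom.id_apply]

/-- `(Φ ⊗ Ψ)(X ⊗ Y) = Φ(X) ⊗ Ψ(Y)`. -/
theorem mapTensor_kronecker {a b a' b' : Type} [Fintype a] [DecidableEq a] [Fintype a']
    [DecidableEq a'] (Φ : Matrix a a ℂ →ₗ[ℂ] Matrix b b ℂ)
    (Ψ : Matrix a' a' ℂ →ₗ[ℂ] Matrix b' b' ℂ) (X : Matrix a a ℂ) (Y : Matrix a' a' ℂ) :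
    mapTensor Φ Ψ (X ⊗ₖ Y) = Φ X ⊗ₖ Ψ Y := by
  have hX : Φ X = ∑ i, ∑ j, X i j • Φ (Matrix.single i j 1) := by
    calc Φ X = Φ (∑ i, ∑ j, Matrix.single i j (X i j)) := by
          rw [← Matrix.matrix_eq_sum_single]
      _ = _ := by
          rw [map_sum]
          refine Finset.sum_congr rfl fun i _ => ?_
          rw [map_sum]
          refine Finset.sum_congr rfl fun j _ => ?_
          rw [← LinearMap.map_smul, Matrix.smul_single, smul_eq_mul, mul_one]
  have hY : Ψ Y = ∑ k, ∑ l, Y k l • Ψ (Matrix.single k l 1) := by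
    calc Ψ Y = Ψ (∑ k, ∑ l, Matrix.single k l (Y k l)) := by
          rw [← Matrix.matrix_eq_sum_single]
      _ = _ := by
          rw [map_sum]
          refine Finset.sum_congr rfl fun k _ => ?_
          rw [map_sum]
          refine Finset.sum_congr rfl fun l _ => ?_
          rw [← LinearMap.map_smul, Matrix.smul_single, smul_eq_mul, mul_one]
  ext ⟨p, q⟩ ⟨r, s⟩
  rw [hX, hY]
  simp only [mapTensor, LinearMap.coe_mk, AddHom.coe_mk, Matrix.kroneckerMap_apply,
    Matrix.sum_apply, Matrix.smul_apply, smul_eq_mul]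
  rw [Finset.sum_mul]
  refine Finset.sum_congr rfl fun i _ => ?_
  rw [Finset.sum_mul]
  refine Finset.sum_congr rfl fun j _ => ?_
  rw [Finset.mul_sum]
  refine Finset.sum_congr rfl fun k _ => ?_
  rw [Finset.mul_sum]
  refine Finset.sum_congr rfl fun l _ => ?_
  ring

/-- Complete positivity: `id_k ⊗ Φ` is positive for every `k`. -/
def IsCompletelyPositive {a b : Type} [Fintype a] [DecidableEq a]
    (Φ : Matrix a a ℂ →ₗ[ℂ] Matrix b b ℂ) : Prop :=
  ∀ (k : ℕ) (X : Matrix (Fin k × a) (Fin k × a) ℂ), X.PosSemidef →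
    (mapTensor (LinearMap.id : Matrix (Fin k) (Fin k) ℂ →ₗ[ℂ] Matrix (Fin k) (Fin k) ℂ)
      Φ X).PosSemidef

/-- A quantum channel: a completely positive and trace-preserving linear map. -/
structure IsChannel {A B : QSystem} (N : Op A →ₗ[ℂ] Op B) : Prop where
  completelyPositive : IsCompletelyPositive N
  trace_preserving : ∀ X : Op A, (N X).trace = X.trace

/-- The tensor product of two maps, as a map between composite systems. -/
def tensorMap {A₁ B₁ A₂ B₂ : QSystem} (N₁ : Op A₁ →ₗ[ℂ] Op B₁) (N₂ : Op A₂ →ₗ[ℂ] Op B₂) :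
    Op (A₁.tensor A₂) →ₗ[ℂ] Op (B₁.tensor B₂) :=
  mapTensor N₁ N₂

/-! ## Mana, max-relative entropy and max-thauma -/

/-- The base-two logarithm of a nonnegative real number, with `log₂ 0 = -∞`. -/
def log₂ (x : ℝ) : EReal := if x ≤ 0 then ⊥ else ((Real.logb 2 x : ℝ) : EReal)

/-- The mana `log₂ max_u ‖P(A_u)‖_{W,1}` of a (Hermiticity-preserving) linear map. -/
def mana {A B : QSystem} (P : Op A →ₗ[ℂ] Op B) : EReal :=
  log₂ (⨆ u : A.Phase, wignerTraceNorm B (P (phasePoint A u)))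

/-- The max-relative entropy `inf {r ∈ ℝ | ρ ≤ 2 ^ r σ}`, which is `+∞` if there is no such `r`. -/
def dMax {n : Type} (ρ σ : Matrix n n ℂ) : EReal :=
  ⨅ (r : ℝ) (_ : ((((2 : ℝ) ^ r : ℝ) : ℂ) • σ - ρ).PosSemidef), (r : EReal)

/-- The max-divergence of maps: the supremum of `D_max((id_R ⊗ N)(ψ) ‖ (id_R ⊗ E)(ψ))` over all
pure states `ψ = |ψ⟩⟨ψ|` of `R ⊗ A`, where the reference system `R` is a copy of `A`. -/
def dMaxMap {A B : QSystem} (N E : Op A →ₗ[ℂ] Op B) : EReal :=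
  ⨆ (ψ : A.Basis × A.Basis → ℂ) (_ : ∑ x, ‖ψ x‖ ^ 2 = 1),
    dMax (mapTensor (LinearMap.id : Op A →ₗ[ℂ] Op A) N (Matrix.vecMulVec ψ (star ψ)))
      (mapTensor (LinearMap.id : Op A →ₗ[ℂ] Op A) E (Matrix.vecMulVec ψ (star ψ)))

/-- The max-thauma of `N`: the infimum of `D_max(N ‖ E)` over all completely positive maps `E` with
mana at most zero. -/
def maxThauma {A B : QSystem} (N : Op A →ₗ[ℂ] Op B) : EReal :=
  ⨅ (E : Op A →ₗ[ℂ] Op B) (_ : IsCompletelyPositive E ∧ mana E ≤ 0), dMaxMap N E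

end

end ChannelMagic

/-! The max-thauma is the logarithm of a minimal norm. If `N ≤ 2^r E` in the completely positive
order and `E` has mana at most zero, then `Φ = 2^r E` dominates `N` and `max_u ‖Φ(A_u)‖_{W,1} ≤
2^r`; conversely, rescaling a dominating `Φ` gives such an `E`. The order can be read off Choi
matrices, because the maximally entangled input is already decisive for `D_max`. Hence `maxThauma N
= log₂ (domNorm N)` (`maxThauma_eq`), and additivity becomes multiplicativity of `domNorm`
(`domNorm_mapTensor`) together with its positivity on channels (`domNorm_pos`).

`domNorm` is the value of a convex conic program whose primal and dual solutions both tensorise.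
Tensor products of dominating maps dominate, and the norm is submultiplicative, which gives `≤`. For
`≥`, Hahn–Banach (`exists_dual_optimum`) yields a functional `L` of the real table `tr[Q_v Φ(P_u)]`
that is bounded by the norm, nonnegative on completely positive maps, and equal to `domNorm N` at
`N`. The tensor product of two such functionals keeps the bound (`functional_tensor_le`). It keeps
positivity because each is represented by a positive semidefinite operator (`witness_posSemidef`),
and these are closed under Kronecker products.

Multiplicativity uses only that the operator families are Hermitian and factorise over subsystems;
`∑ A_u = d • 1` serves positivity alone. -/

namespace ChannelMagic

noncomputable section

set_option linter.unusedSectionVars false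

open scoped ComplexOrder Kronecker

/-! ## Choi matrices -/

section Choi

variable {a b a' b' : Type} [DecidableEq a]

/-- The Choi matrix `∑ |i⟩⟨j| ⊗ Φ(|i⟩⟨j|)` of a linear map. -/
def choi (Φ : Matrix a a ℂ →ₗ[ℂ] Matrix b b ℂ) : Matrix (a × b) (a × b) ℂ :=
  Matrix.of fun x y => Φ (Matrix.single x.1 y.1 1) x.2 y.2

theorem choi_apply (Φ : Matrix a a ℂ →ₗ[ℂ] Matrix b b ℂ) (x y : a × b) :
    choi Φ x y = Φ (Matrix.single x.1 y.1 1) x.2 y.2 := rfl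

theorem choi_sub (Φ Ψ : Matrix a a ℂ →ₗ[ℂ] Matrix b b ℂ) :
    choi (Φ - Ψ) = choi Φ - choi Ψ := rfl

theorem choi_smul (c : ℂ) (Φ : Matrix a a ℂ →ₗ[ℂ] Matrix b b ℂ) :
    choi (c • Φ) = c • choi Φ := rfl

theorem choi_add (Φ Ψ : Matrix a a ℂ →ₗ[ℂ] Matrix b b ℂ) :
    choi (Φ + Ψ) = choi Φ + choi Ψ := rfl

variable [Fintype a] [Fintype a'] [DecidableEq a']

/-- The linear map with a given Choi matrix. -/
def ofChoi (C : Matrix (a × b) (a × b) ℂ) : Matrix a a ℂ →ₗ[ℂ] Matrix b b ℂ where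
  toFun X := Matrix.of fun p q => ∑ i, ∑ j, X i j * C (i, p) (j, q)
  map_add' X Y := by
    ext p q
    simp [add_mul, Finset.sum_add_distrib]
  map_smul' c X := by
    ext p q
    simp [mul_assoc, Finset.mul_sum]

theorem choi_ofChoi (C : Matrix (a × b) (a × b) ℂ) : choi (ofChoi C) = C := by
  ext ⟨i, p⟩ ⟨j, q⟩
  simp [choi_apply, ofChoi, Matrix.single_apply, ite_and]

theorem apply_eq_sum_choi (Φ : Matrix a a ℂ →ₗ[ℂ] Matrix b b ℂ) (X : Matrix a a ℂ) (p q : b) :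
    Φ X p q = ∑ i, ∑ j, X i j * choi Φ (i, p) (j, q) := by
  conv_lhs => rw [Matrix.matrix_eq_sum_single X]
  simp only [map_sum, Matrix.sum_apply, choi_apply]
  refine Finset.sum_congr rfl fun i _ => Finset.sum_congr rfl fun j _ => ?_
  rw [← smul_eq_mul, ← Matrix.smul_apply, ← LinearMap.map_smul, Matrix.smul_single, smul_eq_mul,
    mul_one]

theorem mapTensor_apply (Φ : Matrix a a ℂ →ₗ[ℂ] Matrix b b ℂ)
    (Ψ : Matrix a' a' ℂ →ₗ[ℂ] Matrix b' b' ℂ) (X : Matrix (a × a') (a × a') ℂ) (x y : b × b') :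
    mapTensor Φ Ψ X x y = ∑ i, ∑ j, ∑ k, ∑ l, X (i, k) (j, l) *
      (choi Φ (i, x.1) (j, y.1) * choi Ψ (k, x.2) (l, y.2)) := by
  simp [mapTensor, Matrix.sum_apply, choi_apply]

theorem mapTensor_id_apply (Ψ : Matrix a' a' ℂ →ₗ[ℂ] Matrix b' b' ℂ)
    (X : Matrix (a × a') (a × a') ℂ) (x y : a × b') :
    mapTensor (LinearMap.id : Matrix a a ℂ →ₗ[ℂ] Matrix a a ℂ) Ψ X x y =
      ∑ k, ∑ l, X (x.1, k) (y.1, l) * choi Ψ (k, x.2) (l, y.2) := by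
  rw [mapTensor_apply]
  simp only [choi_apply, LinearMap.id_apply, Matrix.single_apply, ite_and, ite_mul, one_mul,
    zero_mul, mul_ite, mul_zero, Finset.sum_ite_irrel, Finset.sum_const_zero]
  simp

theorem mapTensor_id_sub (Φ Ψ : Matrix a' a' ℂ →ₗ[ℂ] Matrix b' b' ℂ)
    (X : Matrix (a × a') (a × a') ℂ) :
    mapTensor (LinearMap.id : Matrix a a ℂ →ₗ[ℂ] Matrix a a ℂ) (Φ - Ψ) X =
      mapTensor LinearMap.id Φ X - mapTensor LinearMap.id Ψ X := by
  ext x y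
  simp [mapTensor_id_apply, choi_sub, mul_sub]

theorem mapTensor_id_smul (c : ℂ) (Ψ : Matrix a' a' ℂ →ₗ[ℂ] Matrix b' b' ℂ)
    (X : Matrix (a × a') (a × a') ℂ) :
    mapTensor (LinearMap.id : Matrix a a ℂ →ₗ[ℂ] Matrix a a ℂ) (c • Ψ) X =
      c • mapTensor LinearMap.id Ψ X := by
  ext x y
  simp [mapTensor_id_apply, choi_smul, Finset.mul_sum, mul_left_comm]

theorem choi_mapTensor (Φ : Matrix a a ℂ →ₗ[ℂ] Matrix b b ℂ)
    (Ψ : Matrix a' a' ℂ →ₗ[ℂ] Matrix b' b' ℂ) :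
    choi (mapTensor Φ Ψ) = (choi Φ ⊗ₖ choi Ψ).submatrix
      (Equiv.prodProdProdComm a a' b b') (Equiv.prodProdProdComm a a' b b') := by
  ext ⟨⟨i, k⟩, p, r⟩ ⟨⟨j, l⟩, q, s⟩
  have h : (Matrix.single (i, k) (j, l) (1 : ℂ)) =
      Matrix.single i j 1 ⊗ₖ Matrix.single k l 1 := by
    rw [Matrix.single_kronecker_single, mul_one]
  simp [choi_apply, h, mapTensor_kronecker]

/-- If the Choi matrix of `Ψ` is positive semidefinite, then `id ⊗ Ψ` is positive. -/
theorem posSemidef_mapTensor_id [Fintype b'] {Ψ : Matrix a' a' ℂ →ₗ[ℂ] Matrix b' b' ℂ}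
    (hΨ : (choi Ψ).PosSemidef) {X : Matrix (a × a') (a × a') ℂ} (hX : X.PosSemidef) :
    (mapTensor (LinearMap.id : Matrix a a ℂ →ₗ[ℂ] Matrix a a ℂ) Ψ X).PosSemidef := by
  classical
  -- Column `(m, p)` of `S` is `∑ₖ |m,k⟩ ⊗ |k,p⟩`, so conjugation by `S` contracts the second index
  -- of `X` with the input index of the Choi matrix.
  let S : Matrix (((a × a') × (a' × b'))) (a × b') ℂ := Matrix.of fun z x =>
    if z.1.1 = x.1 ∧ z.1.2 = z.2.1 ∧ z.2.2 = x.2 then 1 else 0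
  suffices h : mapTensor (LinearMap.id : Matrix a a ℂ →ₗ[ℂ] Matrix a a ℂ) Ψ X =
      S.conjTranspose * (X ⊗ₖ choi Ψ) * S by
    rw [h]
    exact (hX.kronecker hΨ).conjTranspose_mul_mul_same S
  ext ⟨m, p⟩ ⟨n, q⟩
  rw [mapTensor_id_apply]
  simp only [S, Matrix.mul_apply, Matrix.conjTranspose_apply, Matrix.of_apply,
    Fintype.sum_prod_type, Matrix.kroneckerMap_apply, ite_and, apply_ite star, star_one, star_zero,
    ite_mul, mul_ite, one_mul, mul_one, zero_mul, mul_zero, Finset.sum_ite_irrel,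
    Finset.sum_const_zero, Finset.sum_ite_eq, Finset.sum_ite_eq', Finset.mem_univ, if_true]
  exact Finset.sum_comm

/-- The unnormalised maximally entangled vector. -/
def entangled (a : Type) [DecidableEq a] : a × a → ℂ := fun x => if x.1 = x.2 then 1 else 0

theorem mapTensor_id_entangled (Ψ : Matrix a a ℂ →ₗ[ℂ] Matrix b b ℂ) (c : ℝ) :
    mapTensor (LinearMap.id : Matrix a a ℂ →ₗ[ℂ] Matrix a a ℂ) Ψ
      (Matrix.vecMulVec ((c : ℂ) • entangled a) (star ((c : ℂ) • entangled a))) =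
      (c ^ 2 : ℂ) • choi Ψ := by
  ext ⟨i, p⟩ ⟨j, q⟩
  rw [mapTensor_id_apply]
  simp [Matrix.vecMulVec_apply, entangled, apply_ite (starRingEnd ℂ), ite_mul, mul_ite, pow_two]

/-- Choi's theorem. -/
theorem isCompletelyPositive_iff [Fintype b] (Ψ : Matrix a a ℂ →ₗ[ℂ] Matrix b b ℂ) :
    IsCompletelyPositive Ψ ↔ (choi Ψ).PosSemidef := by
  refine ⟨fun h => ?_, fun h k X hX => posSemidef_mapTensor_id h hX⟩
  -- The definition allows only `Fin k` as reference, so the entangled vector is relabelled to `Fin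
  -- (card a)` and back.
  let e := Fintype.equivFin a
  have h1 := h (Fintype.card a) _ ((Matrix.posSemidef_vecMulVec_self_star (entangled a)).submatrix
    (Prod.map e.symm id))
  have h2 := h1.submatrix (Prod.map e id)
  convert h2 using 1
  ext ⟨i, p⟩ ⟨j, q⟩
  rw [Matrix.submatrix_apply, mapTensor_id_apply]
  simp [Matrix.vecMulVec_apply, entangled, apply_ite (starRingEnd ℂ), ite_mul, mul_ite]

end Choi

/-- The trace of a product of two positive semidefinite matrices is nonnegative. -/
theorem trace_mul_nonneg {n : Type} [Fintype n] [DecidableEq n] {M N : Matrix n n ℂ}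
    (hM : M.PosSemidef) (hN : N.PosSemidef) : 0 ≤ (M * N).trace := by
  open scoped MatrixOrder in
  obtain ⟨Y, rfl⟩ := CStarAlgebra.nonneg_iff_eq_star_mul_self.mp hN.nonneg
  rw [Matrix.star_eq_conjTranspose]
  rw [← Matrix.mul_assoc, Matrix.trace_mul_comm, ← Matrix.mul_assoc]
  exact (hM.mul_mul_conjTranspose_same Y).trace_nonneg

/-! ## Conic duality for sublinear functionals -/

/-- Strong duality for the minimisation of a nonnegative sublinear functional over a translate of a
convex cone; the dual optimum is attained. -/
theorem exists_dual_optimum {E : Type*} [AddCommGroup E] [Module ℝ E] (q : E → ℝ)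
    (hq : ∀ x, 0 ≤ q x) (hqs : ∀ c : ℝ, 0 < c → ∀ x, q (c • x) = c * q x)
    (hqa : ∀ x y, q (x + y) ≤ q x + q y) (K : ConvexCone ℝ E) (hK : 0 ∈ K) (x : E) :
    ∃ L : E →ₗ[ℝ] ℝ, (∀ y, L y ≤ q y) ∧ (∀ k ∈ K, 0 ≤ L k) ∧ L x = ⨅ k : K, q (x + k) := by
  have : Nonempty K := ⟨⟨0, hK⟩⟩
  -- The optimal value as a function of the translate is itself sublinear; Hahn–Banach is applied to
  -- it, not to `q`. Nonnegativity of `q` keeps it finite.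
  set g : E → ℝ := fun y => ⨅ k : K, q (y + k) with hg
  have hbdd (y : E) : BddBelow (Set.range fun k : K => q (y + k)) :=
    ⟨0, by rintro _ ⟨k, rfl⟩; exact hq _⟩
  have hg0 (y : E) : 0 ≤ g y := le_ciInf fun k => hq _
  have hgle (y : E) {k : E} (hk : k ∈ K) : g y ≤ q (y + k) := ciInf_le (hbdd y) ⟨k, hk⟩
  have hq0 : q 0 = 0 := by
    have := hqs 2 two_pos 0
    rw [smul_zero] at this
    linarith
  have hgz : g 0 = 0 := le_antisymm (by simpa [hq0] using hgle 0 hK) (hg0 0)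
  have hgs_le (c : ℝ) (hc : 0 < c) (y : E) : g (c • y) ≤ c * g y := by
    rw [hg, Real.mul_iInf_of_nonneg hc.le]
    refine le_ciInf fun k => (hgle _ (K.smul_mem hc k.2)).trans_eq ?_
    rw [← smul_add, hqs c hc]
  have hgs (c : ℝ) (hc : 0 < c) (y : E) : g (c • y) = c * g y := by
    refine le_antisymm (hgs_le c hc y) ?_
    have := hgs_le c⁻¹ (inv_pos.2 hc) (c • y)
    rw [smul_smul, inv_mul_cancel₀ hc.ne', one_smul] at this
    calc c * g y ≤ c * (c⁻¹ * g (c • y)) := by gcongr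
      _ = g (c • y) := by rw [← mul_assoc, mul_inv_cancel₀ hc.ne', one_mul]
  have hga (y z : E) : g (y + z) ≤ g y + g z := by
    refine le_ciInf_add_ciInf fun k l => (hgle _ (K.add_mem k.2 l.2)).trans ?_
    rw [add_add_add_comm]
    exact hqa _ _
  obtain ⟨f, hfx, hf⟩ : ∃ f : E →ₗ.[ℝ] ℝ, (∃ h : x ∈ f.domain, f ⟨x, h⟩ = g x) ∧
      ∀ y : f.domain, f y ≤ g y := by
    by_cases hx : x = 0
    · subst hx
      exact ⟨⟨⊥, 0⟩, ⟨Submodule.zero_mem _, by simp [hgz]⟩, fun y => hg0 _⟩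
    · refine ⟨LinearPMap.mkSpanSingleton x (g x) hx, ⟨Submodule.mem_span_singleton_self x, ?_⟩, ?_⟩
      · exact LinearPMap.mkSpanSingleton_apply ℝ ℝ hx _
      · rintro ⟨y, hy⟩
        obtain ⟨c, rfl⟩ := Submodule.mem_span_singleton.1 hy
        refine (LinearPMap.mkSpanSingleton'_apply _ _ _ _ hy).trans_le ?_
        rw [smul_eq_mul]
        rcases lt_or_ge 0 c with hc | hc
        · exact (hgs c hc x).ge
        -- On nonpositive multiples of `x` the functional is `≤ 0`, while `g ≥ 0`.
        · exact (mul_nonpos_of_nonpos_of_nonneg hc (hg0 x)).trans (hg0 _)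
  obtain ⟨L, hLf, hL⟩ := exists_extension_of_le_sublinear f g hgs hga hf
  obtain ⟨h, hfx⟩ := hfx
  refine ⟨L, fun y => (hL y).trans (by simpa using hgle y hK), fun k hk => ?_, ?_⟩
  -- Choosing `k` itself as the translate gives `g (-k) ≤ q 0 = 0`.
  · have := (hL (-k)).trans (hgle (-k) hk)
    rw [neg_add_cancel, hq0, map_neg] at this
    linarith
  · exact (hLf ⟨x, h⟩).trans hfx

/-! ## Norms of linear maps relative to families of operators -/

/-- The mixed norm `max_u ∑_v |y (u, v)|`. -/
def rowNorm {U V : Type} [Fintype V] (y : U × V → ℝ) : ℝ := ⨆ u, ∑ v, |y (u, v)|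

section RowNorm

variable {U V U' V' : Type} [Fintype U] [Fintype V] [Nonempty U]
  [Fintype U'] [Fintype V'] [Nonempty U']

theorem rowNorm_nonneg (y : U × V → ℝ) : 0 ≤ rowNorm y :=
  Real.iSup_nonneg fun _ => Finset.sum_nonneg fun _ _ => abs_nonneg _

theorem sum_abs_le_rowNorm (y : U × V → ℝ) (u : U) : ∑ v, |y (u, v)| ≤ rowNorm y :=
  le_ciSup (f := fun u => ∑ v, |y (u, v)|) (Finite.bddAbove_range _) u

theorem rowNorm_smul (c : ℝ) (hc : 0 < c) (y : U × V → ℝ) :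
    rowNorm (c • y) = c * rowNorm y := by
  simp only [rowNorm, Real.mul_iSup_of_nonneg hc.le, Finset.mul_sum, Pi.smul_apply, smul_eq_mul,
    abs_mul, abs_of_pos hc]

theorem rowNorm_add (y z : U × V → ℝ) : rowNorm (y + z) ≤ rowNorm y + rowNorm z := by
  refine ciSup_le fun u => ?_
  refine le_trans ?_ (add_le_add (sum_abs_le_rowNorm y u) (sum_abs_le_rowNorm z u))
  rw [← Finset.sum_add_distrib]
  exact Finset.sum_le_sum fun v _ => abs_add_le _ _

theorem functional_apply [DecidableEq U] [DecidableEq V] (L : (U × V → ℝ) →ₗ[ℝ] ℝ)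
    (y : U × V → ℝ) : L y = ∑ z, L (Pi.single z 1) * y z := by
  rw [LinearMap.pi_apply_eq_sum_univ L y]
  refine Finset.sum_congr rfl fun z _ => ?_
  rw [smul_eq_mul, mul_comm]
  congr 2
  ext w
  simp [Pi.single_apply, eq_comm]

/-- Functionals bounded by the mixed norm have tensor products bounded by the mixed norm. -/
theorem functional_tensor_le {L : (U × V → ℝ) →ₗ[ℝ] ℝ} {L' : (U' × V' → ℝ) →ₗ[ℝ] ℝ}
    (hL : ∀ y, L y ≤ rowNorm y) (hL' : ∀ y, L' y ≤ rowNorm y)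
    (y : (U × U') × (V × V') → ℝ) :
    L' (fun z' => L fun z => y ((z.1, z'.1), (z.2, z'.2))) ≤ rowNorm y := by
  refine (hL' _).trans (ciSup_le fun u' => ?_)
  -- With `u'` fixed, these signs turn the sum of absolute values into one value of `L`, to which
  -- its own bound applies.
  set s : V' → ℝ := fun v' => SignType.sign (L fun z => y ((z.1, u'), (z.2, v')))
  have hs (v' : V') : |s v'| ≤ 1 := by
    simp only [s]
    rcases SignType.sign (L fun z => y ((z.1, u'), (z.2, v'))) with _ | _ | _ <;> simp
  have h : ∑ v', |L fun z => y ((z.1, u'), (z.2, v'))| =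
      L (∑ v', s v' • fun z => y ((z.1, u'), (z.2, v'))) := by
    rw [map_sum]
    refine Finset.sum_congr rfl fun v' _ => ?_
    rw [map_smul, smul_eq_mul, sign_mul_self]
  refine h.trans_le ((hL _).trans (ciSup_le fun u => ?_))
  refine le_trans ?_ (sum_abs_le_rowNorm y (u, u'))
  rw [Fintype.sum_prod_type]
  refine Finset.sum_le_sum fun v _ => ?_
  rw [Finset.sum_apply]
  refine (Finset.abs_sum_le_sum_abs _ _).trans (Finset.sum_le_sum fun v' _ => ?_)
  rw [Pi.smul_apply, smul_eq_mul, abs_mul]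
  exact mul_le_of_le_one_left (abs_nonneg _) (hs v')

end RowNorm

section MapNorm

variable {a b a' b' U V U' V' : Type} [Fintype a] [DecidableEq a] [Fintype b]
  [Fintype a'] [DecidableEq a'] [Fintype b']
  [Fintype U] [Fintype V] [Nonempty U] [Fintype U'] [Fintype V'] [Nonempty U']

/-- The real parts of the numbers `tr[Q_v Φ(P_u)]`. -/
def response (P : U → Matrix a a ℂ) (Q : V → Matrix b b ℂ)
    (Φ : Matrix a a ℂ →ₗ[ℂ] Matrix b b ℂ) : U × V → ℝ :=
  fun z => (Q z.2 * Φ (P z.1)).trace.re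

/-- The norm `max_u ∑_v |tr[Q_v Φ(P_u)]|`. -/
def mapNorm (P : U → Matrix a a ℂ) (Q : V → Matrix b b ℂ)
    (Φ : Matrix a a ℂ →ₗ[ℂ] Matrix b b ℂ) : ℝ :=
  ⨆ u, ∑ v, ‖(Q v * Φ (P u)).trace‖

/-- The least norm of a map that exceeds `N` by a completely positive map. -/
def domNorm (P : U → Matrix a a ℂ) (Q : V → Matrix b b ℂ)
    (N : Matrix a a ℂ →ₗ[ℂ] Matrix b b ℂ) : ℝ :=
  ⨅ Φ : {Φ : Matrix a a ℂ →ₗ[ℂ] Matrix b b ℂ // (choi Φ - choi N).PosSemidef}, mapNorm P Q Φ.1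

/-- The product of two families of operators. -/
def kronFamily (P : U → Matrix a a ℂ) (P' : U' → Matrix a' a' ℂ) :
    U × U' → Matrix (a × a') (a × a') ℂ := fun u => P u.1 ⊗ₖ P' u.2

/-- The operator on `a ⊗ b` that represents a functional of the responses. -/
def witness [DecidableEq U] [DecidableEq V] (P : U → Matrix a a ℂ) (Q : V → Matrix b b ℂ)
    (L : (U × V → ℝ) →ₗ[ℝ] ℝ) : Matrix (a × b) (a × b) ℂ :=
  ∑ z, L (Pi.single z 1) • ((P z.1).transpose ⊗ₖ Q z.2)

/-- Makes each response a linear functional of the Choi matrix, so that functionals of responses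
become operators. -/
theorem trace_mul_apply (P : Matrix a a ℂ) (Q : Matrix b b ℂ)
    (Φ : Matrix a a ℂ →ₗ[ℂ] Matrix b b ℂ) :
    (Q * Φ P).trace = (choi Φ * (P.transpose ⊗ₖ Q)).trace := by
  simp only [Matrix.trace, Matrix.diag_apply, Matrix.mul_apply, Fintype.sum_prod_type,
    Matrix.kroneckerMap_apply, Matrix.transpose_apply, apply_eq_sum_choi Φ P, Finset.mul_sum]
  rw [Finset.sum_comm]
  conv_rhs => rw [Finset.sum_comm]
  refine Finset.sum_congr rfl fun p _ => ?_
  rw [Finset.sum_comm]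
  refine Finset.sum_congr rfl fun i _ => ?_
  rw [Finset.sum_comm]
  refine Finset.sum_congr rfl fun j _ => Finset.sum_congr rfl fun q _ => ?_
  ring

theorem trace_mul_im {n : Type} [Fintype n] {M N : Matrix n n ℂ} (hM : M.IsHermitian)
    (hN : N.IsHermitian) : (M * N).trace.im = 0 := by
  rw [← Complex.conj_eq_iff_im, starRingEnd_apply, ← Matrix.trace_conjTranspose,
    Matrix.conjTranspose_mul, hM.eq, hN.eq, Matrix.trace_mul_comm]

theorem kronecker_transpose_isHermitian {P : Matrix a a ℂ} {Q : Matrix b b ℂ}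
    (hP : P.IsHermitian) (hQ : Q.IsHermitian) : (P.transpose ⊗ₖ Q).IsHermitian := by
  rw [Matrix.IsHermitian, Matrix.conjTranspose_kronecker, hP.transpose.eq, hQ.eq]

theorem trace_mul_apply_im {P : Matrix a a ℂ} {Q : Matrix b b ℂ} (hP : P.IsHermitian)
    (hQ : Q.IsHermitian) {Φ : Matrix a a ℂ →ₗ[ℂ] Matrix b b ℂ} (hΦ : (choi Φ).IsHermitian) :
    (Q * Φ P).trace.im = 0 := by
  rw [trace_mul_apply]
  exact trace_mul_im hΦ (kronecker_transpose_isHermitian hP hQ)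

theorem rowNorm_response {P : U → Matrix a a ℂ} {Q : V → Matrix b b ℂ}
    (hP : ∀ u, (P u).IsHermitian) (hQ : ∀ v, (Q v).IsHermitian)
    {Φ : Matrix a a ℂ →ₗ[ℂ] Matrix b b ℂ} (hΦ : (choi Φ).IsHermitian) :
    rowNorm (response P Q Φ) = mapNorm P Q Φ := by
  simp only [rowNorm, mapNorm, response]
  congr! 3 with u v
  exact (Complex.abs_re_eq_norm.2 (trace_mul_apply_im (hP _) (hQ _) hΦ))

/-- Needs no Hermiticity, so it covers every competitor in `domNorm`. -/
theorem rowNorm_response_le (P : U → Matrix a a ℂ) (Q : V → Matrix b b ℂ)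
    (Φ : Matrix a a ℂ →ₗ[ℂ] Matrix b b ℂ) : rowNorm (response P Q Φ) ≤ mapNorm P Q Φ :=
  ciSup_mono (Finite.bddAbove_range _) fun _ => Finset.sum_le_sum fun _ _ => Complex.abs_re_le_norm _

theorem response_add (P : U → Matrix a a ℂ) (Q : V → Matrix b b ℂ)
    (Φ Ψ : Matrix a a ℂ →ₗ[ℂ] Matrix b b ℂ) :
    response P Q (Φ + Ψ) = response P Q Φ + response P Q Ψ := by
  ext z
  simp [response, mul_add]

theorem response_smul (P : U → Matrix a a ℂ) (Q : V → Matrix b b ℂ) (c : ℝ)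
    (Φ : Matrix a a ℂ →ₗ[ℂ] Matrix b b ℂ) :
    response P Q ((c : ℂ) • Φ) = c • response P Q Φ := by
  ext z
  simp [response]

theorem mapNorm_nonneg (P : U → Matrix a a ℂ) (Q : V → Matrix b b ℂ)
    (Φ : Matrix a a ℂ →ₗ[ℂ] Matrix b b ℂ) : 0 ≤ mapNorm P Q Φ :=
  Real.iSup_nonneg fun _ => Finset.sum_nonneg fun _ _ => norm_nonneg _

theorem sum_norm_le_mapNorm (P : U → Matrix a a ℂ) (Q : V → Matrix b b ℂ)
    (Φ : Matrix a a ℂ →ₗ[ℂ] Matrix b b ℂ) (u : U) :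
    ∑ v, ‖(Q v * Φ (P u)).trace‖ ≤ mapNorm P Q Φ :=
  le_ciSup (f := fun u => ∑ v, ‖(Q v * Φ (P u)).trace‖) (Finite.bddAbove_range _) u

theorem domNorm_le (P : U → Matrix a a ℂ) (Q : V → Matrix b b ℂ)
    {Φ N : Matrix a a ℂ →ₗ[ℂ] Matrix b b ℂ} (h : (choi Φ - choi N).PosSemidef) :
    domNorm P Q N ≤ mapNorm P Q Φ :=
  ciInf_le (f := fun Φ : {Φ : Matrix a a ℂ →ₗ[ℂ] Matrix b b ℂ //
    (choi Φ - choi N).PosSemidef} => mapNorm P Q Φ.1)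
    ⟨0, by rintro _ ⟨Φ, rfl⟩; exact mapNorm_nonneg P Q Φ.1⟩ ⟨Φ, h⟩

instance nonempty_dominating (N : Matrix a a ℂ →ₗ[ℂ] Matrix b b ℂ) :
    Nonempty {Φ : Matrix a a ℂ →ₗ[ℂ] Matrix b b ℂ // (choi Φ - choi N).PosSemidef} :=
  ⟨⟨N, by rw [sub_self]; exact Matrix.PosSemidef.zero⟩⟩

theorem functional_response [DecidableEq U] [DecidableEq V] (P : U → Matrix a a ℂ)
    (Q : V → Matrix b b ℂ) (Φ : Matrix a a ℂ →ₗ[ℂ] Matrix b b ℂ) (L : (U × V → ℝ) →ₗ[ℝ] ℝ) :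
    L (response P Q Φ) = (choi Φ * witness P Q L).trace.re := by
  rw [functional_apply, witness, Matrix.mul_sum, Matrix.trace_sum, Complex.re_sum]
  refine Finset.sum_congr rfl fun z _ => ?_
  rw [Matrix.mul_smul, Matrix.trace_smul, Complex.real_smul, Complex.re_ofReal_mul,
    ← trace_mul_apply, response]

theorem witness_isHermitian [DecidableEq U] [DecidableEq V] {P : U → Matrix a a ℂ}
    {Q : V → Matrix b b ℂ} (hP : ∀ u, (P u).IsHermitian) (hQ : ∀ v, (Q v).IsHermitian)
    (L : (U × V → ℝ) →ₗ[ℝ] ℝ) : (witness P Q L).IsHermitian := by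
  rw [Matrix.IsHermitian, witness, Matrix.conjTranspose_sum]
  refine Finset.sum_congr rfl fun z _ => ?_
  rw [Matrix.conjTranspose_smul, star_trivial,
    (kronecker_transpose_isHermitian (hP z.1) (hQ z.2)).eq]

/-- A functional that is nonnegative on completely positive maps has a positive semidefinite
representing operator. -/
theorem witness_posSemidef [DecidableEq U] [DecidableEq V] {P : U → Matrix a a ℂ}
    {Q : V → Matrix b b ℂ} (hP : ∀ u, (P u).IsHermitian) (hQ : ∀ v, (Q v).IsHermitian)
    {L : (U × V → ℝ) →ₗ[ℝ] ℝ}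
    (hL : ∀ Φ : Matrix a a ℂ →ₗ[ℂ] Matrix b b ℂ, (choi Φ).PosSemidef → 0 ≤ L (response P Q Φ)) :
    (witness P Q L).PosSemidef := by
  have hH := witness_isHermitian hP hQ L
  refine .of_dotProduct_mulVec_nonneg hH fun x => ?_
  have hx : (Matrix.vecMulVec x (star x)).PosSemidef := Matrix.posSemidef_vecMulVec_self_star x
  -- Every rank-one projector `|x⟩⟨x|` is the Choi matrix of a completely positive map; testing `L`
  -- there gives the quadratic form of the witness at `x`.
  have h := hL (ofChoi (Matrix.vecMulVec x (star x))) (by rwa [choi_ofChoi])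
  rw [functional_response, choi_ofChoi] at h
  have h' := trace_mul_im hx.isHermitian hH
  have : star x ⬝ᵥ (witness P Q L).mulVec x =
      (Matrix.vecMulVec x (star x) * witness P Q L).trace := by
    rw [Matrix.trace_mul_comm, Matrix.mul_vecMulVec, Matrix.trace_vecMulVec, dotProduct_comm]
  rw [this, Complex.nonneg_iff]
  exact ⟨h, h'.symm⟩

/-- The dual description of `domNorm`. -/
theorem exists_dual_domNorm {P : U → Matrix a a ℂ}
    {Q : V → Matrix b b ℂ} (hP : ∀ u, (P u).IsHermitian) (hQ : ∀ v, (Q v).IsHermitian)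
    {N : Matrix a a ℂ →ₗ[ℂ] Matrix b b ℂ} (hN : (choi N).PosSemidef) :
    ∃ L : (U × V → ℝ) →ₗ[ℝ] ℝ, (∀ y, L y ≤ rowNorm y) ∧
      (∀ Φ : Matrix a a ℂ →ₗ[ℂ] Matrix b b ℂ, (choi Φ).PosSemidef → 0 ≤ L (response P Q Φ)) ∧
      L (response P Q N) = domNorm P Q N := by
  -- The translate of this cone by the response of `N` consists of the responses of all maps
  -- dominating `N`.
  let K : ConvexCone ℝ (U × V → ℝ) :=
    { carrier := {y | ∃ Φ : Matrix a a ℂ →ₗ[ℂ] Matrix b b ℂ,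
        (choi Φ).PosSemidef ∧ response P Q Φ = y}
      smul_mem' := by
        rintro c hc _ ⟨Φ, hΦ, rfl⟩
        exact ⟨(c : ℂ) • Φ, hΦ.smul (Complex.zero_le_real.2 hc.le), response_smul P Q c Φ⟩
      add_mem' := by
        rintro _ ⟨Φ, hΦ, rfl⟩ _ ⟨Ψ, hΨ, rfl⟩
        exact ⟨Φ + Ψ, hΦ.add hΨ, response_add P Q Φ Ψ⟩ }
  have hK : 0 ∈ K := ⟨0, Matrix.PosSemidef.zero, by ext; simp [response]⟩
  obtain ⟨L, h1, h2, h3⟩ := exists_dual_optimum rowNorm rowNorm_nonneg rowNorm_smul rowNorm_add K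
    hK (response P Q N)
  refine ⟨L, h1, fun Φ hΦ => h2 _ ⟨Φ, hΦ, rfl⟩, h3.trans (le_antisymm ?_ ?_)⟩
  · refine le_ciInf fun Φ => ?_
    refine (ciInf_le ⟨0, ?_⟩ ⟨response P Q (Φ.1 - N), Φ.1 - N, Φ.2, rfl⟩).trans ?_
    · rintro _ ⟨k, rfl⟩
      exact rowNorm_nonneg _
    · rw [← response_add, add_sub_cancel]
      exact rowNorm_response_le P Q Φ.1
  · have : Nonempty K := ⟨⟨0, hK⟩⟩
    refine le_ciInf ?_
    rintro ⟨_, Φ, hΦ, rfl⟩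
    rw [← response_add, rowNorm_response hP hQ (Φ := N + Φ) (hN.add hΦ).isHermitian]
    exact domNorm_le P Q (by rwa [choi_add, add_sub_cancel_left])

/-! ### Multiplicativity of the dominating norm -/

theorem trace_kron_mapTensor (P : Matrix a a ℂ) (Q : Matrix b b ℂ) (P' : Matrix a' a' ℂ)
    (Q' : Matrix b' b' ℂ) (Φ : Matrix a a ℂ →ₗ[ℂ] Matrix b b ℂ)
    (Φ' : Matrix a' a' ℂ →ₗ[ℂ] Matrix b' b' ℂ) :
    ((Q ⊗ₖ Q') * mapTensor Φ Φ' (P ⊗ₖ P')).trace = (Q * Φ P).trace * (Q' * Φ' P').trace := by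
  rw [mapTensor_kronecker, ← Matrix.mul_kronecker_mul, Matrix.trace_kronecker]

theorem mapNorm_mapTensor_le (P : U → Matrix a a ℂ) (Q : V → Matrix b b ℂ)
    (P' : U' → Matrix a' a' ℂ) (Q' : V' → Matrix b' b' ℂ)
    (Φ : Matrix a a ℂ →ₗ[ℂ] Matrix b b ℂ) (Φ' : Matrix a' a' ℂ →ₗ[ℂ] Matrix b' b' ℂ) :
    mapNorm (kronFamily P P') (kronFamily Q Q') (mapTensor Φ Φ') ≤
      mapNorm P Q Φ * mapNorm P' Q' Φ' := by
  refine ciSup_le fun u => ?_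
  simp only [kronFamily, trace_kron_mapTensor, norm_mul]
  rw [Fintype.sum_prod_type]
  dsimp only
  rw [← Finset.sum_mul_sum]
  exact mul_le_mul (sum_norm_le_mapNorm P Q Φ _) (sum_norm_le_mapNorm P' Q' Φ' _)
    (Finset.sum_nonneg fun _ _ => norm_nonneg _) (mapNorm_nonneg P Q Φ)

theorem choi_mapTensor_sub_posSemidef {Φ N : Matrix a a ℂ →ₗ[ℂ] Matrix b b ℂ}
    {Φ' N' : Matrix a' a' ℂ →ₗ[ℂ] Matrix b' b' ℂ} (hN : (choi N).PosSemidef)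
    (hN' : (choi N').PosSemidef) (h : (choi Φ - choi N).PosSemidef)
    (h' : (choi Φ' - choi N').PosSemidef) :
    (choi (mapTensor Φ Φ') - choi (mapTensor N N')).PosSemidef := by
  have hΦ' : (choi Φ').PosSemidef := by simpa using h'.add hN'
  -- Telescoping through `N ⊗ Φ'` writes the difference as a sum of Kronecker products of positive
  -- semidefinite matrices.
  have heq : choi Φ ⊗ₖ choi Φ' - choi N ⊗ₖ choi N' =
      (choi Φ - choi N) ⊗ₖ choi Φ' + choi N ⊗ₖ (choi Φ' - choi N') := by
    ext x y
    simp only [Matrix.sub_apply, Matrix.add_apply, Matrix.kroneckerMap_apply]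
    ring
  have hpos := (h.kronecker hΦ').add (hN.kronecker h')
  rw [← heq] at hpos
  rw [choi_mapTensor, choi_mapTensor]
  exact hpos.submatrix (Equiv.prodProdProdComm a a' b b')

theorem domNorm_mapTensor_le (P : U → Matrix a a ℂ) (Q : V → Matrix b b ℂ)
    (P' : U' → Matrix a' a' ℂ) (Q' : V' → Matrix b' b' ℂ)
    {N : Matrix a a ℂ →ₗ[ℂ] Matrix b b ℂ} {N' : Matrix a' a' ℂ →ₗ[ℂ] Matrix b' b' ℂ}
    (hN : (choi N).PosSemidef) (hN' : (choi N').PosSemidef) :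
    domNorm (kronFamily P P') (kronFamily Q Q') (mapTensor N N') ≤
      domNorm P Q N * domNorm P' Q' N' := by
  have h0 : 0 ≤ domNorm P' Q' N' := Real.iInf_nonneg fun _ => mapNorm_nonneg _ _ _
  refine (le_ciInf fun Φ => ?_).trans_eq (Real.iInf_mul_of_nonneg h0 _).symm
  refine (le_ciInf fun Φ' => ?_).trans_eq (Real.mul_iInf_of_nonneg (mapNorm_nonneg P Q Φ.1) _).symm
  exact (domNorm_le _ _ (choi_mapTensor_sub_posSemidef hN hN' Φ.2 Φ'.2)).trans
    (mapNorm_mapTensor_le P Q P' Q' Φ.1 Φ'.1)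

/-- The tensor product of functionals is written as an iterated application; its representing
operator is the Kronecker product of the witnesses, with the tensor factors reordered. -/
theorem functional_tensor_response [DecidableEq U] [DecidableEq V] [DecidableEq U']
    [DecidableEq V'] (P : U → Matrix a a ℂ) (Q : V → Matrix b b ℂ)
    (P' : U' → Matrix a' a' ℂ) (Q' : V' → Matrix b' b' ℂ)
    (L : (U × V → ℝ) →ₗ[ℝ] ℝ) (L' : (U' × V' → ℝ) →ₗ[ℝ] ℝ)
    (Φ : Matrix (a × a') (a × a') ℂ →ₗ[ℂ] Matrix (b × b') (b × b') ℂ) :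
    L' (fun z' => L fun z => response (kronFamily P P') (kronFamily Q Q') Φ
        ((z.1, z'.1), (z.2, z'.2))) =
      (choi Φ * (witness P Q L ⊗ₖ witness P' Q' L').submatrix
        (Equiv.prodProdProdComm a a' b b') (Equiv.prodProdProdComm a a' b b')).trace.re := by
  have h : (witness P Q L ⊗ₖ witness P' Q' L').submatrix
        (Equiv.prodProdProdComm a a' b b') (Equiv.prodProdProdComm a a' b b') =
      ∑ z', ∑ z, (L' (Pi.single z' 1) * L (Pi.single z 1)) •
        ((P z.1 ⊗ₖ P' z'.1).transpose ⊗ₖ (Q z.2 ⊗ₖ Q' z'.2)) := by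
    ext x y
    simp only [witness, Matrix.submatrix_apply, Matrix.kroneckerMap_apply, Matrix.sum_apply,
      Matrix.smul_apply, Matrix.transpose_apply, Finset.sum_mul_sum, Complex.real_smul,
      Equiv.prodProdProdComm_apply]
    rw [Finset.sum_comm]
    refine Finset.sum_congr rfl fun _ _ => Finset.sum_congr rfl fun _ _ => ?_
    push_cast
    ring
  set R := response (kronFamily P P') (kronFamily Q Q') Φ
  have hL (z' : U' × V') : L (fun z => R ((z.1, z'.1), (z.2, z'.2))) =
      ∑ z, L (Pi.single z 1) * R ((z.1, z'.1), (z.2, z'.2)) :=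
    functional_apply L fun z => R ((z.1, z'.1), (z.2, z'.2))
  rw [h, functional_apply L']
  simp only [hL]
  simp only [Matrix.trace_sum, Complex.re_sum, Finset.mul_sum]
  refine Finset.sum_congr rfl fun _ _ => Finset.sum_congr rfl fun _ _ => ?_
  rw [Matrix.mul_smul, Matrix.trace_smul, Complex.real_smul, Complex.re_ofReal_mul,
    ← trace_mul_apply, mul_assoc]
  rfl

theorem le_domNorm_mapTensor {P : U → Matrix a a ℂ} {Q : V → Matrix b b ℂ}
    {P' : U' → Matrix a' a' ℂ} {Q' : V' → Matrix b' b' ℂ}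
    (hP : ∀ u, (P u).IsHermitian) (hQ : ∀ v, (Q v).IsHermitian)
    (hP' : ∀ u, (P' u).IsHermitian) (hQ' : ∀ v, (Q' v).IsHermitian)
    {N : Matrix a a ℂ →ₗ[ℂ] Matrix b b ℂ} {N' : Matrix a' a' ℂ →ₗ[ℂ] Matrix b' b' ℂ}
    (hN : (choi N).PosSemidef) (hN' : (choi N').PosSemidef) :
    domNorm P Q N * domNorm P' Q' N' ≤
      domNorm (kronFamily P P') (kronFamily Q Q') (mapTensor N N') := by
  classical
  obtain ⟨L, hle, hpos, hval⟩ := exists_dual_domNorm hP hQ hN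
  obtain ⟨L', hle', hpos', hval'⟩ := exists_dual_domNorm hP' hQ' hN'
  refine le_ciInf fun Φ => ?_
  have hW := ((witness_posSemidef hP hQ hpos).kronecker (witness_posSemidef hP' hQ' hpos')).submatrix
    (Equiv.prodProdProdComm a a' b b')
  have hprod : L' (fun z' => L fun z => response (kronFamily P P') (kronFamily Q Q')
      (mapTensor N N') ((z.1, z'.1), (z.2, z'.2))) = domNorm P Q N * domNorm P' Q' N' := by
    -- The real part of a product of traces factorises because the traces for `N` are real.
    rw [← hval, ← hval', ← smul_eq_mul, ← map_smul]
    congr 1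
    ext z'
    rw [Pi.smul_apply, smul_eq_mul, mul_comm, ← smul_eq_mul, ← map_smul]
    congr 1
    ext z
    simp only [response, kronFamily, trace_kron_mapTensor, Complex.mul_re, Pi.smul_apply,
      smul_eq_mul, trace_mul_apply_im (hP _) (hQ _) hN.isHermitian, zero_mul, sub_zero]
    ring
  -- It remains to compare the product functional at `N ⊗ N'` and at `Φ`; the difference pairs two
  -- positive semidefinite operators.
  refine le_trans ?_ ((functional_tensor_le hle hle' _).trans (rowNorm_response_le _ _ Φ.1))
  rw [← hprod, functional_tensor_response, functional_tensor_response, ← sub_nonneg,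
    ← Complex.sub_re, ← Matrix.trace_sub, ← Matrix.sub_mul]
  exact (Complex.nonneg_iff.1 (trace_mul_nonneg Φ.2 hW)).1

/-- Multiplicativity of `domNorm`. -/
theorem domNorm_mapTensor {P : U → Matrix a a ℂ} {Q : V → Matrix b b ℂ}
    {P' : U' → Matrix a' a' ℂ} {Q' : V' → Matrix b' b' ℂ}
    (hP : ∀ u, (P u).IsHermitian) (hQ : ∀ v, (Q v).IsHermitian)
    (hP' : ∀ u, (P' u).IsHermitian) (hQ' : ∀ v, (Q' v).IsHermitian)
    {N : Matrix a a ℂ →ₗ[ℂ] Matrix b b ℂ} {N' : Matrix a' a' ℂ →ₗ[ℂ] Matrix b' b' ℂ}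
    (hN : (choi N).PosSemidef) (hN' : (choi N').PosSemidef) :
    domNorm (kronFamily P P') (kronFamily Q Q') (mapTensor N N') =
      domNorm P Q N * domNorm P' Q' N' :=
  le_antisymm (domNorm_mapTensor_le P Q P' Q' hN hN')
    (le_domNorm_mapTensor hP hQ hP' hQ' hN hN')

end MapNorm

/-! ## Phase-space point operators -/

section Qudit

variable {d : ℕ} [NeZero d]

theorem boostZ_pow (m : ℕ) :
    boostZ d ^ m = Matrix.diagonal fun j : ZMod d => ZMod.stdAddChar ((m : ZMod d) * j) := by
  rw [boostZ, Matrix.diagonal_pow]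
  congr 1
  ext j
  have h : ZMod.stdAddChar j = Complex.exp (2 * Real.pi * Complex.I / d) ^ j.val := by
    conv_lhs => rw [← ZMod.natCast_zmod_val j, ← Int.cast_natCast, ZMod.stdAddChar_coe]
    rw [← Complex.exp_nat_mul]
    congr 1
    push_cast
    ring
  rw [Pi.pow_apply, ← h, ← AddChar.map_nsmul_eq_pow, nsmul_eq_mul]

theorem shiftX_pow_apply (n : ℕ) (i j : ZMod d) :
    (shiftX d ^ n) i j = if i = j + n then 1 else 0 := by
  induction n generalizing j with
  | zero => simp [Matrix.one_apply]
  | succ n ih =>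
    rw [pow_succ, Matrix.mul_apply]
    simp only [ih]
    simp [shiftX, add_assoc, add_comm (1 : ZMod d)]

/-- The inverse of two modulo an odd number. -/
def half (d : ℕ) : ZMod d := ((d + 1) / 2 : ℕ)

/-- For odd `d`, `τ = ω ^ ((d + 1) / 2)`, so powers of `τ` depend only on the exponent modulo `d`.
-/
theorem tau_zpow (hd : Odd d) (m : ℤ) :
    tau d ^ m = ZMod.stdAddChar ((m : ZMod d) * half d) := by
  obtain ⟨k, hk⟩ := hd
  have h2 : (d + 1) / 2 = k + 1 := by omega
  have h : ((m : ZMod d) * half d) = ((m * (k + 1) : ℤ) : ZMod d) := by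
    rw [half, h2]
    push_cast
    ring
  rw [h, ZMod.stdAddChar_coe, tau, ← Complex.exp_int_mul]
  congr 1
  have : (d : ℂ) = 2 * k + 1 := by exact_mod_cast hk
  rw [show (d + 1 : ℂ) = 2 * (k + 1) by rw [this]; ring]
  push_cast
  ring

theorem two_mul_half (hd : Odd d) : 2 * half d = 1 := by
  obtain ⟨k, hk⟩ := hd
  have h2 : 2 * ((d + 1) / 2) = d + 1 := by omega
  have := congrArg (Nat.cast : ℕ → ZMod d) h2
  push_cast at this
  simpa [half] using this

/-- The Heisenberg--Weyl operators of a qudit, entry by entry. -/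
def quditWeyl (u : ZMod d × ZMod d) : Matrix (ZMod d) (ZMod d) ℂ :=
  Matrix.of fun i j =>
    if i = j + u.2 then ZMod.stdAddChar (u.1 * i - u.1 * u.2 * half d) else 0

/-- The phase-space point operators of a qudit, entry by entry. -/
def quditPoint (u : ZMod d × ZMod d) : Matrix (ZMod d) (ZMod d) ℂ :=
  Matrix.of fun i j => if i + j = 2 * u.2 then ZMod.stdAddChar (u.1 * (i - j)) else 0

theorem smul_boostZ_mul_shiftX (hd : Odd d) (u : ZMod d × ZMod d) :
    tau d ^ (-((u.1.val : ℤ) * (u.2.val : ℤ))) • (boostZ d ^ u.1.val * shiftX d ^ u.2.val) =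
      quditWeyl u := by
  ext i j
  rw [Matrix.smul_apply, boostZ_pow, Matrix.diagonal_mul, shiftX_pow_apply, tau_zpow hd, quditWeyl,
    Matrix.of_apply]
  simp only [ZMod.natCast_zmod_val, mul_ite, mul_one, mul_zero, smul_eq_mul]
  rw [← AddChar.map_add_eq_mul]
  congr 2
  push_cast
  simp only [ZMod.natCast_zmod_val]
  ring

theorem sum_stdAddChar (b : ZMod d) :
    ∑ a : ZMod d, ZMod.stdAddChar (a * b) = if b = 0 then (d : ℂ) else 0 := by
  rw [AddChar.sum_mulShift b (ZMod.isPrimitive_stdAddChar d), ZMod.card]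
  push_cast
  rfl

/-- The point operator at the origin is the parity `j ↦ -j`: the shift forces `u.2 = i - j`, the
phase becomes `u.1 * (i + j) / 2`, and the character sum over `u.1` leaves only `i + j = 0`. -/
theorem sum_quditWeyl (hd : Odd d) :
    (1 / (d : ℂ)) • ∑ u, quditWeyl u = quditPoint (0 : ZMod d × ZMod d) := by
  have h0 : (d : ℂ) ≠ 0 := Nat.cast_ne_zero.2 (NeZero.ne d)
  ext i j
  rw [Matrix.smul_apply, Matrix.sum_apply, Fintype.sum_prod_type]
  have h (a : ZMod d) : ∑ b : ZMod d, quditWeyl (a, b) i j =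
      ZMod.stdAddChar (a * (half d * (i + j))) := by
    rw [Finset.sum_eq_single (i - j)]
    · rw [quditWeyl, Matrix.of_apply, if_pos (by ring)]
      congr 1
      linear_combination (-a * i) * two_mul_half hd
    · intro b _ hb
      exact if_neg fun h => hb (by rw [h]; ring)
    · simp
  have h2 : half d * (i + j) = 0 ↔ i + j = 0 := by
    refine ⟨fun h => ?_, fun h => by rw [h, mul_zero]⟩
    linear_combination 2 * h - (i + j) * two_mul_half hd
  simp only [h, sum_stdAddChar, h2, quditPoint]
  by_cases hij : i + j = 0 <;> simp [hij, h0]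

theorem quditWeyl_mul_mul (u : ZMod d × ZMod d) :
    quditWeyl u * quditPoint 0 * (quditWeyl u).conjTranspose = quditPoint u := by
  ext i j
  simp only [Matrix.mul_apply, Matrix.conjTranspose_apply]
  rw [Finset.sum_eq_single (j - u.2), Finset.sum_eq_single (i - u.2)]
  · have h : i - u.2 + (j - u.2) = 0 ↔ i + j = 2 * u.2 := by
      rw [← sub_eq_zero (a := i + j)]
      ring_nf
    simp only [quditWeyl, quditPoint, Matrix.of_apply, sub_add_cancel, if_true, Prod.fst_zero,
      Prod.snd_zero, mul_zero, zero_mul, h, AddChar.map_zero_eq_one]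
    split_ifs
    · rw [mul_one, Complex.star_def, ← AddChar.map_neg_eq_conj, ← AddChar.map_add_eq_mul]
      congr 1
      ring
    · simp
  · intro b _ hb
    rw [quditWeyl, Matrix.of_apply, if_neg fun h => hb (by rw [h]; ring), zero_mul]
  · simp
  · intro b _ hb
    rw [quditWeyl, Matrix.of_apply, if_neg fun h => hb (by rw [h]; ring), star_zero, mul_zero]
  · simp

theorem quditPoint_zero_isHermitian : (quditPoint (0 : ZMod d × ZMod d)).IsHermitian := by
  ext i j
  simp [quditPoint, add_comm j i, apply_ite (starRingEnd ℂ)]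

/-- Summing over `u.1` kills the off-diagonal entries; on the diagonal exactly one `u.2`
contributes, since two is invertible. -/
theorem sum_quditPoint (hd : Odd d) :
    ∑ u : ZMod d × ZMod d, quditPoint u = (d : ℂ) • 1 := by
  ext i j
  rw [Matrix.sum_apply, Fintype.sum_prod_type_right]
  simp only [quditPoint, Matrix.of_apply, Finset.sum_ite_irrel, Finset.sum_const_zero,
    sum_stdAddChar, sub_eq_zero, Matrix.smul_apply, Matrix.one_apply, smul_eq_mul, mul_ite, mul_one,
    mul_zero]
  by_cases hij : i = j
  · subst hij
    have h (b : ZMod d) : i + i = 2 * b ↔ i = b := by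
      refine ⟨fun h => ?_, fun h => by rw [h]; ring⟩
      linear_combination half d * h - (i - b) * two_mul_half hd
    simp [h]
  · simp [hij]

theorem phasePointZero_qudit (hp : d.Prime) (hd : Odd d) :
    phasePointZero (.qudit d hp hd) = quditPoint (0 : ZMod d × ZMod d) := by
  refine Eq.trans ?_ (sum_quditWeyl hd)
  have hdim : (QSystem.qudit d hp hd).dim = d := ZMod.card d
  rw [phasePointZero, hdim]
  exact congrArg _ (Finset.sum_congr rfl fun u _ => smul_boostZ_mul_shiftX hd u)

theorem phasePoint_qudit (hp : d.Prime) (hd : Odd d) (u : ZMod d × ZMod d) :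
    phasePoint (.qudit d hp hd) u = quditPoint u := by
  have hw : weyl (.qudit d hp hd) u = quditWeyl u := smul_boostZ_mul_shiftX hd u
  have h0 := phasePointZero_qudit hp hd
  change weyl (.qudit d hp hd) u * phasePointZero (.qudit d hp hd) *
    (weyl (.qudit d hp hd) u).conjTranspose = quditPoint u
  rw [hw, h0]
  exact quditWeyl_mul_mul u

end Qudit

/-! ### Point operators of composite systems -/

theorem dim_tensor (A B : QSystem) : (A.tensor B).dim = A.dim * B.dim :=
  Fintype.card_prod A.Basis B.Basis

theorem phasePointZero_tensor (A B : QSystem) :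
    phasePointZero (A.tensor B) =
      (show Matrix (A.Basis × B.Basis) (A.Basis × B.Basis) ℂ from
        phasePointZero A ⊗ₖ phasePointZero B) := by
  change (1 / ((A.tensor B).dim : ℂ)) • ∑ u : A.Phase × B.Phase, weyl A u.1 ⊗ₖ weyl B u.2 =
    phasePointZero A ⊗ₖ phasePointZero B
  ext x y
  simp only [phasePointZero, dim_tensor, Matrix.smul_apply, Matrix.sum_apply,
    Matrix.kroneckerMap_apply, Fintype.sum_prod_type, ← Finset.sum_mul_sum, smul_eq_mul]
  push_cast
  ring

theorem phasePoint_tensor (A B : QSystem) :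
    phasePoint (A.tensor B) = kronFamily (phasePoint A) (phasePoint B) := by
  ext1 u
  rw [phasePoint, phasePointZero_tensor]
  change (weyl A u.1 ⊗ₖ weyl B u.2) * (phasePointZero A ⊗ₖ phasePointZero B) *
    (weyl A u.1 ⊗ₖ weyl B u.2).conjTranspose = phasePoint A u.1 ⊗ₖ phasePoint B u.2
  rw [Matrix.conjTranspose_kronecker, ← Matrix.mul_kronecker_mul, ← Matrix.mul_kronecker_mul,
    phasePoint, phasePoint]

theorem phasePointZero_isHermitian : (A : QSystem) → (phasePointZero A).IsHermitian
  | .trivial => by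
      change ((1 / ((QSystem.trivial).dim : ℂ)) • ∑ _u : Unit, (1 : Op .trivial)).IsHermitian
      simp [Matrix.IsHermitian]
  | .qudit d hp hd => by
      have : NeZero d := ⟨hp.ne_zero⟩
      rw [phasePointZero_qudit]
      exact quditPoint_zero_isHermitian
  | .tensor A B => by
      rw [phasePointZero_tensor]
      change (phasePointZero A ⊗ₖ phasePointZero B).IsHermitian
      rw [Matrix.IsHermitian, Matrix.conjTranspose_kronecker, (phasePointZero_isHermitian A).eq,
        (phasePointZero_isHermitian B).eq]

theorem phasePoint_isHermitian (A : QSystem) (u : A.Phase) : (phasePoint A u).IsHermitian :=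
  Matrix.isHermitian_mul_mul_conjTranspose _ (phasePointZero_isHermitian A)

theorem sum_phasePoint : (A : QSystem) → ∑ u, phasePoint A u = (A.dim : ℂ) • 1
  | .trivial => by
      have h : (QSystem.trivial).dim = 1 := rfl
      have h0 : phasePointZero .trivial = 1 := by
        change (1 / ((QSystem.trivial).dim : ℂ)) • ∑ _u : Unit, (1 : Op .trivial) = 1
        simp [h]
      have hu (u : QSystem.trivial.Phase) : phasePoint .trivial u = 1 := by
        rw [phasePoint, h0]
        change (1 : Op .trivial) * 1 * (1 : Op .trivial).conjTranspose = 1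
        simp
      have hc : Fintype.card QSystem.trivial.Phase = 1 := rfl
      rw [Finset.sum_congr rfl fun u _ => hu u, Finset.sum_const, Finset.card_univ, hc, h,
        Nat.cast_one, one_smul, one_smul]
  | .qudit d hp hd => by
      have : NeZero d := ⟨hp.ne_zero⟩
      have hdim : (QSystem.qudit d hp hd).dim = d := ZMod.card d
      rw [hdim]
      exact (Finset.sum_congr rfl fun u _ => phasePoint_qudit hp hd u).trans (sum_quditPoint hd)
  | .tensor A B => by
      rw [phasePoint_tensor, dim_tensor]
      change ∑ u : A.Phase × B.Phase, phasePoint A u.1 ⊗ₖ phasePoint B u.2 =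
        ((A.dim * B.dim : ℕ) : ℂ) • (1 : Matrix (A.Basis × B.Basis) (A.Basis × B.Basis) ℂ)
      have h : ∑ u : A.Phase × B.Phase, phasePoint A u.1 ⊗ₖ phasePoint B u.2 =
          (∑ u, phasePoint A u) ⊗ₖ (∑ u, phasePoint B u) := by
        ext x y
        simp only [Matrix.sum_apply, Matrix.kroneckerMap_apply, Fintype.sum_prod_type,
          ← Finset.sum_mul_sum]
      rw [h, sum_phasePoint A, sum_phasePoint B, Matrix.smul_kronecker, Matrix.kronecker_smul,
        Matrix.one_kronecker_one, smul_smul, Nat.cast_mul]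

/-! ## The max-thauma as the logarithm of a norm -/

/-- The operators `A_u / d`, whose traces against an operator are its Wigner function. -/
def wignerOp (A : QSystem) (u : A.Phase) : Op A := (1 / (A.dim : ℂ)) • phasePoint A u

theorem wignerOp_isHermitian (A : QSystem) (u : A.Phase) : (wignerOp A u).IsHermitian := by
  rw [Matrix.IsHermitian, wignerOp, Matrix.conjTranspose_smul, (phasePoint_isHermitian A u).eq]
  simp

theorem dim_pos (A : QSystem) : 0 < A.dim := by
  induction A with
  | trivial => exact Nat.one_pos
  | qudit d hp hd =>
    have : NeZero d := ⟨hp.ne_zero⟩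
    exact hp.pos.trans_eq (ZMod.card d).symm
  | tensor A B hA hB => exact dim_tensor A B ▸ Nat.mul_pos hA hB

theorem sum_wignerOp (A : QSystem) : ∑ u, wignerOp A u = 1 := by
  have : (A.dim : ℂ) ≠ 0 := Nat.cast_ne_zero.2 (dim_pos A).ne'
  simp only [wignerOp]
  rw [← Finset.smul_sum, sum_phasePoint, smul_smul, one_div, inv_mul_cancel₀ this, one_smul]

theorem wignerOp_tensor (A B : QSystem) :
    wignerOp (A.tensor B) = kronFamily (wignerOp A) (wignerOp B) := by
  ext1 u
  rw [wignerOp, phasePoint_tensor, dim_tensor]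
  simp only [kronFamily, wignerOp, Matrix.smul_kronecker, Matrix.kronecker_smul, smul_smul]
  congr 1
  push_cast
  ring

theorem mana_eq {A B : QSystem} (Φ : Op A →ₗ[ℂ] Op B) :
    mana Φ = log₂ (mapNorm (phasePoint A) (wignerOp B) Φ) := by
  simp [mana, mapNorm, wignerTraceNorm, wigner, wignerOp]

theorem log₂_nonpos_iff (x : ℝ) : log₂ x ≤ 0 ↔ x ≤ 1 := by
  rw [log₂]
  split_ifs with h
  · exact ⟨fun _ => h.trans zero_le_one, fun _ => bot_le⟩
  · rw [← EReal.coe_zero, EReal.coe_le_coe_iff, Real.logb_nonpos_iff one_lt_two (not_le.1 h)]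

theorem mapNorm_smul {A B : QSystem} {c : ℝ} (hc : 0 ≤ c) (Φ : Op A →ₗ[ℂ] Op B) :
    mapNorm (phasePoint A) (wignerOp B) ((c : ℂ) • Φ) =
      c * mapNorm (phasePoint A) (wignerOp B) Φ := by
  simp [mapNorm, Real.mul_iSup_of_nonneg hc, Finset.mul_sum, abs_of_nonneg hc]

/-- The norm relevant for the max-thauma is positive on channels. -/
theorem domNorm_pos {A B : QSystem} {N : Op A →ₗ[ℂ] Op B} (hN : IsChannel N) :
    0 < domNorm (phasePoint A) (wignerOp B) N := by
  have hd : (0 : ℝ) < A.dim := Nat.cast_pos.2 (dim_pos A)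
  have hU : (0 : ℝ) < Fintype.card A.Phase := Nat.cast_pos.2 Fintype.card_pos
  -- The maximum over `u` is at least the average, and the sum over `u` and `v` of the traces is `d
  -- * tr Φ(1)`, whose real part is at least `d * tr N(1) = d²`.
  suffices h : (A.dim * A.dim : ℝ) / Fintype.card A.Phase ≤
      domNorm (phasePoint A) (wignerOp B) N from (div_pos (mul_pos hd hd) hU).trans_le h
  refine le_ciInf fun ⟨Φ, hΦ⟩ => ?_
  rw [div_le_iff₀' hU]
  have h1 : ∑ u, ∑ v, (wignerOp B v * Φ (phasePoint A u)).trace = A.dim * (Φ 1).trace := by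
    simp only [← Matrix.trace_sum, ← Finset.sum_mul, ← map_sum, sum_wignerOp,
      sum_phasePoint, one_mul, map_smul, Matrix.trace_smul, smul_eq_mul]
  have h2 : (A.dim : ℝ) ≤ (Φ 1).trace.re := by
    have h := (Complex.nonneg_iff.1 hΦ.trace_nonneg).1
    -- Pairing with the identities shows that the Choi matrix of `Φ - N` has trace `tr (Φ - N)(1)`.
    have h3 := trace_mul_apply (1 : Op A) (1 : Op B) (Φ - N)
    rw [Matrix.transpose_one, Matrix.one_kronecker_one, Matrix.mul_one, Matrix.one_mul, choi_sub,
      LinearMap.sub_apply, Matrix.trace_sub, hN.trace_preserving, Matrix.trace_one] at h3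
    rw [← h3, Complex.sub_re, Complex.natCast_re, sub_nonneg] at h
    exact h
  calc (A.dim * A.dim : ℝ) ≤ A.dim * (Φ 1).trace.re := by gcongr
    _ = ((A.dim : ℂ) * (Φ 1).trace).re := by simp
    _ ≤ ‖∑ u, ∑ v, (wignerOp B v * Φ (phasePoint A u)).trace‖ := by
      rw [h1]
      exact Complex.re_le_norm _
    _ ≤ ∑ u, ∑ v, ‖(wignerOp B v * Φ (phasePoint A u)).trace‖ :=
      (norm_sum_le _ _).trans (Finset.sum_le_sum fun u _ => norm_sum_le _ _)
    _ ≤ ∑ _u : A.Phase, mapNorm (phasePoint A) (wignerOp B) Φ :=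
      Finset.sum_le_sum fun u _ => sum_norm_le_mapNorm _ _ Φ u
    _ = _ := by rw [Finset.sum_const, Finset.card_univ, nsmul_eq_mul]

theorem sum_norm_sq_entangled (A : QSystem) :
    ∑ x, ‖((((√A.dim)⁻¹ : ℝ) : ℂ) • entangled A.Basis) x‖ ^ 2 = 1 := by
  have hd : (0 : ℝ) < A.dim := Nat.cast_pos.2 (dim_pos A)
  have h : ∑ x, ‖((((√A.dim)⁻¹ : ℝ) : ℂ) • entangled A.Basis) x‖ ^ 2 =
      ∑ i : A.Basis, ∑ j : A.Basis, if i = j then (A.dim : ℝ)⁻¹ else 0 := by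
    rw [Fintype.sum_prod_type]
    refine Finset.sum_congr rfl fun i _ => Finset.sum_congr rfl fun j _ => ?_
    by_cases hij : i = j <;> simp [entangled, hij, Real.sq_sqrt hd.le]
  rw [h]
  simp only [Finset.sum_ite_eq, Finset.mem_univ, if_true, Finset.sum_const, Finset.card_univ,
    nsmul_eq_mul]
  exact mul_inv_cancel₀ hd.ne'

/-- Any exponent feasible for `D_max(N ‖ E)` is feasible for the Choi matrices. -/
theorem le_dMaxMap {A B : QSystem} (N E : Op A →ₗ[ℂ] Op B) (x : EReal)
    (h : ∀ r : ℝ, (choi ((((2 : ℝ) ^ r : ℝ) : ℂ) • E) - choi N).PosSemidef → x ≤ r) :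
    x ≤ dMaxMap N E := by
  -- The normalised maximally entangled state is used as input; it reproduces the Choi matrices up
  -- to the factor `1 / d`, which is then scaled away.
  refine le_iSup₂_of_le _ (sum_norm_sq_entangled A) (le_iInf₂ fun r hr => h r ?_)
  rw [mapTensor_id_entangled, mapTensor_id_entangled] at hr
  have hd : (0 : ℝ) < A.dim := Nat.cast_pos.2 (dim_pos A)
  have hc : (0 : ℝ) < (√A.dim)⁻¹ ^ 2 := by positivity
  have := hr.smul (Complex.zero_le_real.2 (inv_pos.2 hc).le)
  convert this using 1
  rw [choi_smul, smul_comm, ← smul_sub, smul_smul, ← Complex.ofReal_pow, ← Complex.ofReal_mul,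
    inv_mul_cancel₀ hc.ne', Complex.ofReal_one, one_smul]

theorem dMaxMap_le {A B : QSystem} {N E : Op A →ₗ[ℂ] Op B} {r : ℝ}
    (h : (choi ((((2 : ℝ) ^ r : ℝ) : ℂ) • E) - choi N).PosSemidef) : dMaxMap N E ≤ r := by
  refine iSup₂_le fun ψ _ => iInf₂_le r ?_
  rw [← mapTensor_id_smul, ← mapTensor_id_sub]
  exact posSemidef_mapTensor_id (Ψ := (((2 : ℝ) ^ r : ℝ) : ℂ) • E - N) h (Matrix.posSemidef_vecMulVec_self_star ψ)

theorem maxThauma_eq {A B : QSystem} {N : Op A →ₗ[ℂ] Op B} (hN : IsCompletelyPositive N)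
    (hpos : 0 < domNorm (phasePoint A) (wignerOp B) N) :
    maxThauma N = (Real.logb 2 (domNorm (phasePoint A) (wignerOp B) N) : ℝ) := by
  refine le_antisymm ?_ (le_iInf₂ fun E hE => le_dMaxMap N E _ fun r hr => ?_)
  -- Attainment of the infimum is avoided: for `z` above the logarithm some dominating `Φ` has norm
  -- below `2 ^ z`, and `2 ^ (-z) • Φ` is feasible.
  · refine EReal.le_of_forall_lt_iff_le.1 fun z hz => ?_
    rw [EReal.coe_lt_coe_iff, Real.logb_lt_iff_lt_rpow one_lt_two hpos] at hz
    obtain ⟨⟨Φ, hΦ⟩, hlt⟩ := exists_lt_of_ciInf_lt hz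
    have hz0 : (0 : ℝ) < 2 ^ z := Real.rpow_pos_of_pos two_pos z
    have hΦpos : (choi Φ).PosSemidef := by
      simpa using hΦ.add ((isCompletelyPositive_iff N).1 hN)
    suffices hE : IsCompletelyPositive (((((2 : ℝ) ^ z)⁻¹ : ℝ) : ℂ) • Φ) ∧
        mana (A := A) (B := B) (((((2 : ℝ) ^ z)⁻¹ : ℝ) : ℂ) • Φ) ≤ 0 by
      have hle : maxThauma N ≤ dMaxMap N (((((2 : ℝ) ^ z)⁻¹ : ℝ) : ℂ) • Φ) :=
        iInf₂_le (f := fun (E : Op A →ₗ[ℂ] Op B) (_ : IsCompletelyPositive E ∧ mana E ≤ 0) =>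
          dMaxMap N E) _ hE
      refine hle.trans (dMaxMap_le ?_)
      rwa [smul_smul, ← Complex.ofReal_mul, mul_inv_cancel₀ hz0.ne', Complex.ofReal_one, one_smul]
    constructor
    · rw [isCompletelyPositive_iff, choi_smul]
      exact hΦpos.smul (Complex.zero_le_real.2 (inv_pos.2 hz0).le)
    · rw [mana_eq, log₂_nonpos_iff, mapNorm_smul (inv_pos.2 hz0).le, inv_mul_le_iff₀ hz0, mul_one]
      exact hlt.le
  · have h1 := domNorm_le (phasePoint A) (wignerOp B) hr
    have h2 := hE.2
    have hr0 : (0 : ℝ) < 2 ^ r := Real.rpow_pos_of_pos two_pos r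
    rw [mana_eq, log₂_nonpos_iff] at h2
    rw [mapNorm_smul hr0.le] at h1
    rw [EReal.coe_le_coe_iff, Real.logb_le_iff_le_rpow one_lt_two hpos]
    exact h1.trans (mul_le_of_le_one_right hr0.le h2)

theorem domNorm_tensorMap {A₁ B₁ A₂ B₂ : QSystem} {N₁ : Op A₁ →ₗ[ℂ] Op B₁}
    {N₂ : Op A₂ →ₗ[ℂ] Op B₂} (hN₁ : IsCompletelyPositive N₁) (hN₂ : IsCompletelyPositive N₂) :
    domNorm (phasePoint (A₁.tensor A₂)) (wignerOp (B₁.tensor B₂)) (tensorMap N₁ N₂) =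
      domNorm (phasePoint A₁) (wignerOp B₁) N₁ * domNorm (phasePoint A₂) (wignerOp B₂) N₂ := by
  rw [phasePoint_tensor, wignerOp_tensor]
  exact domNorm_mapTensor (phasePoint_isHermitian A₁) (wignerOp_isHermitian B₁)
    (phasePoint_isHermitian A₂) (wignerOp_isHermitian B₂)
    ((isCompletelyPositive_iff N₁).1 hN₁) ((isCompletelyPositive_iff N₂).1 hN₂)

theorem isCompletelyPositive_tensorMap {A₁ B₁ A₂ B₂ : QSystem} {N₁ : Op A₁ →ₗ[ℂ] Op B₁}
    {N₂ : Op A₂ →ₗ[ℂ] Op B₂} (hN₁ : IsCompletelyPositive N₁) (hN₂ : IsCompletelyPositive N₂) :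
    IsCompletelyPositive (tensorMap N₁ N₂) := by
  refine (isCompletelyPositive_iff (b := B₁.Basis × B₂.Basis) (a := A₁.Basis × A₂.Basis)
    (mapTensor N₁ N₂)).2 ?_
  rw [choi_mapTensor]
  exact (((isCompletelyPositive_iff N₁).1 hN₁).kronecker
    ((isCompletelyPositive_iff N₂).1 hN₂)).submatrix _

end

end ChannelMagic

theorem mainTheorem7 {A₁ B₁ A₂ B₂ : ChannelMagic.QSystem}
    (N₁ : ChannelMagic.Op A₁ →ₗ[ℂ] ChannelMagic.Op B₁)
    (N₂ : ChannelMagic.Op A₂ →ₗ[ℂ] ChannelMagic.Op B₂)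
    (hN₁ : ChannelMagic.IsChannel N₁) (hN₂ : ChannelMagic.IsChannel N₂) :
    ChannelMagic.maxThauma (ChannelMagic.tensorMap N₁ N₂) =
      ChannelMagic.maxThauma N₁ + ChannelMagic.maxThauma N₂ := by
  -- Positivity keeps both logarithms finite, so the logarithm of the product splits over the reals
  -- before passing to `EReal`.
  have h₁ := ChannelMagic.domNorm_pos hN₁
  have h₂ := ChannelMagic.domNorm_pos hN₂
  have h := ChannelMagic.domNorm_tensorMap hN₁.completelyPositive hN₂.completelyPositive
  rw [ChannelMagic.maxThauma_eq (ChannelMagic.isCompletelyPositive_tensorMap hN₁.completelyPositive hN₂.completelyPositive)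
    (h ▸ mul_pos h₁ h₂), ChannelMagic.maxThauma_eq hN₁.completelyPositive h₁,
    ChannelMagic.maxThauma_eq hN₂.completelyPositive h₂, h, Real.logb_mul h₁.ne' h₂.ne', EReal.coe_add]
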